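/- Let $1\le k<n$ be integers. The $n$ candidates, having ranks $1$ (best) to $n$, arrive one by one in an order that is uniformly distributed over the $n!$ orderings; exactly one is to be chosen, on arrival, and the choice is a success if the chosen candidate is one of the $k$ best of all $n$. For a non-decreasing sequence $(s_1,\dots,s_k)$ of integers with $l\le s_l<n$ for $1\le l\le k$ (and $s_{k+1}:=n-1$), the threshold policy with this sequence chooses the $i_0$-th candidate, where $i_0\in\{1,\dots,n\}$ is the smallest integer for which there is $1\le l\le k$ such that $s_l<i_0\le s_{l+1}$ and the $i_0$-th candidate is one of the $l$ best of the first $i_0$ candidates; if there is no such $i_0$, it chooses the $n$-th candidate. Such a sequence is called optimal if it maximizes the probability of success of its threshold policy among all such sequences. Put $$\delta_{k,n}:=\begin{cases}-\frac1n\sum_{j=1}^{n-1}\frac1j,&k=1,\\[1mm] \frac{(n-k)!}{n!},&k>1,\end{cases}$$ and, for $1\le l\le k$ and $x\in\{1,\dots,n-l\}$, $$d_l(x):=\begin{cases}-\frac kn-\frac1{\binom nk}\sum_{j=1}^{x}\frac1j\binom{n-j-1}{k-1},&l=1,\\[1mm] \frac{k\cdot x!\,(n-l-x)!}{l(l-1)\,n!}\sum_{j=0}^{l-2}\binom{k-1}{j}\binom{n-k}{x+l-j-1},&1<l\le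 k.\end{cases}$$ For $l=k,k-1,\dots,1$ successively, let $t_l$ be the smallest $x\in\{1,\dots,n-l\}$ satisfying $$d_l(x)\le\frac1l\sum_{i=l}^{k-1}\Bigl(\prod_{j=l+1}^{i}t_j\Bigr)d_i(t_{i+1})+\frac1l\Bigl(\prod_{j=l+1}^{k}t_j\Bigr)\delta_{k,n}$$ (empty sums are $0$ and empty products are $1$). Then every $t_l$ is well defined (such an $x$ exists), and the sequence $(s_1,\dots,s_k)$ with $s_l=t_l+l-1$ is an optimal sequence. -/

import Mathlib

namespace Secretary

/-- An ordering of the `n` candidates is a permutation `π` of `Fin n`: the candidate arriving at the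
(1-based) time `i + 1` has absolute rank `π i + 1`, rank `1` being the best. The relative rank of
that candidate is the number of candidates met so far, itself included, that are at least as good. -/
def relRank {n : ℕ} (π : Equiv.Perm (Fin n)) (i : Fin n) : ℕ :=
  (Finset.univ.filter fun j : Fin n => j ≤ i ∧ π j ≤ π i).card

/-- The sequence `(s 1, …, s k)` continued by `s (k + 1) = n - 1`. -/
def extend (n k : ℕ) (s : ℕ → ℕ) (l : ℕ) : ℕ :=
  if l ≤ k then s l else n - 1

/-- An admissible sequence: `(s 1, …, s k)` is non-decreasing with `l ≤ s l < n`.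
Only the values of `s` at `1, …, k` matter. -/
def IsAdmissible (n k : ℕ) (s : ℕ → ℕ) : Prop :=
  (∀ l, 1 ≤ l → l ≤ k → l ≤ s l ∧ s l < n) ∧
    ∀ l m, 1 ≤ l → l ≤ m → m ≤ k → s l ≤ s m

/-- At time `i + 1` the threshold policy given by `s` is ready to accept the present candidate:
for some `1 ≤ l ≤ k` the time lies in `(s l, s (l + 1)]` and the candidate is one of the `l` best of
those met so far. -/
def Acceptable {n : ℕ} (k : ℕ) (s : ℕ → ℕ) (π : Equiv.Perm (Fin n)) (i : Fin n) : Prop :=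
  ∃ l, 1 ≤ l ∧ l ≤ k ∧ s l < (i : ℕ) + 1 ∧ (i : ℕ) + 1 ≤ extend n k s (l + 1) ∧ relRank π i ≤ l

/-- The threshold policy given by `s` chooses the candidate arriving at time `i + 1`: the first
acceptable one or, if there is none, the last candidate. -/
def Chooses {n : ℕ} (k : ℕ) (s : ℕ → ℕ) (π : Equiv.Perm (Fin n)) (i : Fin n) : Prop :=
  (Acceptable k s π i ∧ ∀ j, j < i → ¬ Acceptable k s π j) ∨
    ((∀ j, ¬ Acceptable k s π j) ∧ (i : ℕ) + 1 = n)

/-- The policy succeeds for the ordering `π`: the chosen candidate has absolute rank at most `k`. -/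
def Succeeds {n : ℕ} (k : ℕ) (s : ℕ → ℕ) (π : Equiv.Perm (Fin n)) : Prop :=
  ∃ i, Chooses k s π i ∧ (π i : ℕ) + 1 ≤ k

open Classical in
/-- Probability of success of the threshold policy given by `s`, all `n!` orderings being equally
likely. -/
noncomputable def successProb (n k : ℕ) (s : ℕ → ℕ) : ℝ :=
  ((Finset.univ.filter fun π : Equiv.Perm (Fin n) => Succeeds k s π).card : ℝ) / (n.factorial : ℝ)

/-- An optimal sequence maximizes the probability of success among all admissible sequences. -/
def IsOptimal (n k : ℕ) (s : ℕ → ℕ) : Prop :=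
  IsAdmissible n k s ∧ ∀ s', IsAdmissible n k s' → successProb n k s' ≤ successProb n k s

/-- The number `δ_{k,n}`. -/
noncomputable def delta (k n : ℕ) : ℝ :=
  if k = 1 then -(1 / (n : ℝ)) * ∑ j ∈ Finset.Icc 1 (n - 1), 1 / (j : ℝ)
  else ((n - k).factorial : ℝ) / (n.factorial : ℝ)

/-- The number `d_l(x)`, for `1 ≤ l ≤ k` and `1 ≤ x ≤ n - l`. In this range no subtraction of natural
numbers below is truncated; for `1 < l` the range `j < l - 1` is `0 ≤ j ≤ l - 2`. -/
noncomputable def d (n k l x : ℕ) : ℝ :=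
  if l = 1 then
    -((k : ℝ) / n) -
      1 / (n.choose k : ℝ) *
        ∑ j ∈ Finset.Icc 1 x, ((n - j - 1).choose (k - 1) : ℝ) / (j : ℝ)
  else
    ((k : ℝ) * (x.factorial : ℝ) * ((n - l - x).factorial : ℝ)) /
        ((l : ℝ) * ((l : ℝ) - 1) * (n.factorial : ℝ)) *
      ∑ j ∈ Finset.range (l - 1), ((k - 1).choose j : ℝ) * ((n - k).choose (x + l - j - 1) : ℝ)

/-- The right-hand side of the inequality that determines `t l`; it depends on
`t (l + 1), …, t k` only. -/
noncomputable def rhs (n k : ℕ) (t : ℕ → ℕ) (l : ℕ) : ℝ :=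
  1 / (l : ℝ) *
      ∑ i ∈ Finset.Ico l k, (∏ j ∈ Finset.Icc (l + 1) i, (t j : ℝ)) * d n k i (t (i + 1)) +
    1 / (l : ℝ) * (∏ j ∈ Finset.Icc (l + 1) k, (t j : ℝ)) * delta k n

/-- For every `1 ≤ l ≤ k`, `t l` is the smallest `x ∈ {1, …, n - l}` with `d_l(x) ≤ rhs`. -/
def IsThresholdSystem (n k : ℕ) (t : ℕ → ℕ) : Prop :=
  ∀ l, 1 ≤ l → l ≤ k → IsLeast {x : ℕ | 1 ≤ x ∧ x ≤ n - l ∧ d n k l x ≤ rhs n k t l} (t l)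

end Secretary

/-!
The relative ranks `a 1, …, a n` of the candidates determine the ordering (they form its Lehmer code,
`code_bijective`), so they are independent, `a i` being uniform on `{1, …, i}`. A candidate with
relative rank `y` among the first `i` arrivals is one of the `k` best if and only if at least `y` of
the `k` best are among these `i`; the probability of this is a hypergeometric tail `tail n k i y`.
Hence the success probability of a threshold policy is obtained by backward induction
(`successProb_eq_value`): if `L i` is the number of thresholds below `i` and `V i` is the value of
continuing after time `i`, then `V n = 0` and
`i * V (i - 1) = ∑ y ∈ {1, …, i}, (if y ≤ L i then tail n k i y else V i)`.

Between two consecutive thresholds the level `L i` is a constant `l`, and the recursion telescopes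
after division by the falling factorial `i (i - 1) ⋯ (i - l + 1)`. The numbers `d l x` are designed so
that, with `i = x + l`,
`tail n k i l - V i = i (i - 1) ⋯ (i - l + 1) * l * (rhs l - d l x)` (`tail_sub_value`).
This rests on two identities between hypergeometric weights: `d_sub_d_succ` (one step in time at the
same level; it also shows that `d l` is non-increasing) and `d_succ_level` (change of level at a
threshold).

Thus `t l` is the first `x` from which stopping with relative rank `l` is at least as good as
continuing. A backward induction on time (`isGreedyAt`) shows that the policy prescribes the better of
stopping and continuing at every time and for every relative rank: `tail` is non-increasing in the
rank and non-decreasing in time, whereas the value of a greedy policy is non-increasing in time. The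
constraint `1 ≤ t l` does no harm, because a candidate that is the worst so far is one of the `k`
best with probability at most `k / n`, which is what the last candidate offers. A greedy policy
maximizes the value (`value_le_value_of_isGreedyAt`).
-/

namespace Secretary

/-! ### The number of successful candidates among the first arrivals -/

/-- The hypergeometric weight: the probability that exactly `h` of the `k` best of `n` candidates are
among the first `m` arrivals. The guard `h ≤ m` is needed because `m - h` is truncated. -/
noncomputable def hyper (n k m h : ℕ) : ℝ :=
  if h ≤ m then ((k.choose h : ℝ) * ((n - k).choose (m - h) : ℝ)) / (n.choose m : ℝ) else 0

/-- The probability that at least `y` of the `k` best candidates are among the first `m` arrivals.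
This is also the conditional probability that a candidate whose relative rank among the first `m`
arrivals is `y` is one of the `k` best. -/
noncomputable def tail (n k m y : ℕ) : ℝ := ∑ h ∈ Finset.Ico y (k + 1), hyper n k m h

/-- The expectation of the number of the `k` best candidates among the first `m` arrivals, restricted
to the event that this number is less than `l`. -/
noncomputable def truncMean (n k m l : ℕ) : ℝ := ∑ h ∈ Finset.range l, (h : ℝ) * hyper n k m h

lemma hyper_nonneg (n k m h : ℕ) : 0 ≤ hyper n k m h := by
  unfold hyper; split_ifs <;> positivity

lemma hyper_eq_zero_of_lt {n k m h : ℕ} (hh : k < h) : hyper n k m h = 0 := by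
  simp [hyper, Nat.choose_eq_zero_of_lt hh]

lemma hyper_eq_zero_of_time_lt {n k m h : ℕ} (hh : m < h) : hyper n k m h = 0 := by
  simp [hyper, not_le.2 hh]

lemma cast_choose_succ_mul (a b : ℕ) :
    (a.choose (b + 1) : ℝ) * (b + 1) = (a.choose b : ℝ) * ((a : ℝ) - b) := by
  rcases le_or_gt b a with h | h
  · have := Nat.choose_succ_right_eq a b
    rw [← Nat.cast_sub h]
    exact_mod_cast this
  · simp [Nat.choose_eq_zero_of_lt h, Nat.choose_eq_zero_of_lt (h.trans (Nat.lt_succ_self b))]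

/-- Forgetting the last of `m + 1` arrivals: it is one of the `h` good ones among them with
probability `h / (m + 1)`. -/
lemma hyper_backward {n k m : ℕ} (hk : k ≤ n) (hm : m < n) (y : ℕ) :
    ((m : ℝ) + 1) * hyper n k m y =
      ((m : ℝ) + 1 - y) * hyper n k (m + 1) y + ((y : ℝ) + 1) * hyper n k (m + 1) (y + 1) := by
  rcases lt_trichotomy y (m + 1) with h | h | h
  · obtain ⟨b, rfl⟩ : ∃ b, m = y + b := ⟨m - y, by omega⟩
    have e1 : y + b + 1 - y = b + 1 := by omega
    have e2 : y + b + 1 - (y + 1) = b := by omega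
    have e3 : y + b - y = b := by omega
    have c1 := cast_choose_succ_mul n (y + b)
    have c2 := cast_choose_succ_mul (n - k) b
    have c3 := cast_choose_succ_mul k y
    have p1 : (0 : ℝ) < n.choose (y + b) := by exact_mod_cast Nat.choose_pos hm.le
    have p2 : (0 : ℝ) < n.choose (y + b + 1) := by exact_mod_cast Nat.choose_pos hm
    rw [hyper, hyper, hyper, if_pos (by omega), if_pos (by omega), if_pos (by omega), e1, e2, e3]
    rw [Nat.cast_sub hk] at c2
    push_cast at c1 ⊢
    have key : (n.choose (y + b + 1) : ℝ) * (y + b + 1) *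
        ((k.choose y : ℝ) * ((n - k).choose b : ℝ)) =
        n.choose (y + b) * ((b + 1) * (k.choose y * (n - k).choose (b + 1)) +
          (y + 1) * (k.choose (y + 1) * (n - k).choose b)) := by
      linear_combination ((k.choose y : ℝ) * ((n - k).choose b : ℝ)) * c1 -
        (n.choose (y + b) : ℝ) * k.choose y * c2 -
        (n.choose (y + b) : ℝ) * ((n - k).choose b : ℝ) * c3
    field_simp
    linear_combination key
  · subst h
    rw [hyper_eq_zero_of_time_lt (Nat.lt_succ_self m),
      hyper_eq_zero_of_time_lt (Nat.lt_succ_self (m + 1))]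
    push_cast; ring
  · rw [hyper_eq_zero_of_time_lt h, hyper_eq_zero_of_time_lt (show m < y by omega),
      hyper_eq_zero_of_time_lt (show m + 1 < y + 1 by omega)]
    ring

lemma tail_eq_add (n k m y : ℕ) : tail n k m y = hyper n k m y + tail n k m (y + 1) := by
  rcases lt_or_ge y (k + 1) with h | h
  · exact Finset.sum_eq_sum_Ico_succ_bot h _
  · simp [tail, hyper_eq_zero_of_lt (show k < y by omega), Finset.Ico_eq_empty_of_le h,
      Finset.Ico_eq_empty_of_le (h.trans (Nat.le_succ y))]

lemma tail_eq_zero_of_lt {n k m y : ℕ} (h : k < y) : tail n k m y = 0 := by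
  simp [tail, Finset.Ico_eq_empty_of_le (show k + 1 ≤ y from h)]

lemma tail_nonneg (n k m y : ℕ) : 0 ≤ tail n k m y :=
  Finset.sum_nonneg fun _ _ => hyper_nonneg _ _ _ _

lemma tail_antitone (n k m : ℕ) : Antitone (tail n k m) :=
  antitone_nat_of_succ_le fun y => by
    rw [tail_eq_add n k m y]; linarith [hyper_nonneg n k m y]

/-- One more arrival raises the count to at least `y` exactly if that arrival is one of the `y` good
ones among `m + 1`. -/
lemma tail_succ_sub {n k m : ℕ} (hk : k ≤ n) (hm : m < n) (y : ℕ) :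
    ((m : ℝ) + 1) * (tail n k (m + 1) y - tail n k m y) = y * hyper n k (m + 1) y := by
  suffices H : ∀ j y, k < y + j →
      ((m : ℝ) + 1) * (tail n k (m + 1) y - tail n k m y) = y * hyper n k (m + 1) y from
    H (k + 1) y (by omega)
  intro j
  induction j with
  | zero =>
    intro y hy
    simp [tail_eq_zero_of_lt (show k < y from hy), hyper_eq_zero_of_lt (show k < y from hy)]
  | succ j ih =>
    intro y hy
    have h1 := ih (y + 1) (by omega)
    have h2 := hyper_backward hk hm y
    rw [tail_eq_add n k (m + 1) y, tail_eq_add n k m y]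
    push_cast at h1
    linear_combination h1 - h2

lemma tail_le_tail_succ {n k m : ℕ} (hk : k ≤ n) (hm : m < n) (y : ℕ) :
    tail n k m y ≤ tail n k (m + 1) y := by
  have h := tail_succ_sub hk hm y
  have h2 : (0 : ℝ) ≤ y * hyper n k (m + 1) y := mul_nonneg (by positivity) (hyper_nonneg _ _ _ _)
  rw [← h] at h2
  have := nonneg_of_mul_nonneg_right h2 (by positivity)
  linarith

lemma tail_mono_time {n k m m' : ℕ} (hk : k ≤ n) (hmm : m ≤ m') (hm : m' ≤ n) (y : ℕ) :
    tail n k m y ≤ tail n k m' y := by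
  induction m', hmm using Nat.le_induction with
  | base => exact le_rfl
  | succ a ha ih => exact (ih (by omega)).trans (tail_le_tail_succ hk hm y)

lemma hyper_end {n k : ℕ} (hk : k ≤ n) (h : ℕ) : hyper n k n h = if h = k then 1 else 0 := by
  rcases lt_trichotomy h k with hh | hh | hh
  · rw [if_neg hh.ne, hyper, if_pos (by omega),
      Nat.choose_eq_zero_of_lt (show n - k < n - h by omega)]
    simp
  · subst hh; simp [hyper, hk]
  · rw [if_neg hh.ne', hyper_eq_zero_of_lt hh]

lemma tail_end {n k : ℕ} (hk : k ≤ n) (y : ℕ) : tail n k n y = if y ≤ k then 1 else 0 := by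
  simp [tail, hyper_end hk, Finset.sum_ite_eq']

/-- All of the first `m` candidates are among the `k` best with probability at most `k / n`. -/
lemma tail_self_le {n k m : ℕ} (hk : k ≤ n) (hm : 1 ≤ m) (hmn : m ≤ n) :
    tail n k m m ≤ (k : ℝ) / n := by
  have e : ∀ m, tail n k m m = hyper n k m m := fun m => by
    have : tail n k m (m + 1) = 0 := Finset.sum_eq_zero fun h hh =>
      hyper_eq_zero_of_time_lt (by rw [Finset.mem_Ico] at hh; omega)
    rw [tail_eq_add, this, add_zero]
  rw [e]
  induction m, hm using Nat.le_induction with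
  | base => simp [hyper]
  | succ a ha ih =>
    have h := hyper_backward hk (show a < n by omega) a
    have h0 := hyper_nonneg n k (a + 1) a
    have : ((a : ℝ) + 1) * hyper n k (a + 1) (a + 1) ≤ (a + 1) * hyper n k a a := by
      rw [h]; nlinarith
    exact (le_of_mul_le_mul_left this (by positivity)).trans (ih (by omega))

lemma truncMean_succ (n k m l : ℕ) :
    truncMean n k m (l + 1) = truncMean n k m l + l * hyper n k m l := Finset.sum_range_succ _ _

lemma truncMean_nonneg (n k m l : ℕ) : 0 ≤ truncMean n k m l :=
  Finset.sum_nonneg fun _ _ => mul_nonneg (by positivity) (hyper_nonneg _ _ _ _)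

lemma truncMean_backward {n k m : ℕ} (hk : k ≤ n) (hm : m < n) (l : ℕ) :
    ((m : ℝ) + 1) * truncMean n k m l =
      m * truncMean n k (m + 1) l + l * ((l : ℝ) - 1) * hyper n k (m + 1) l := by
  induction l with
  | zero => simp [truncMean]
  | succ l ih =>
    have h := hyper_backward hk hm l
    rw [truncMean_succ, truncMean_succ]
    push_cast
    linear_combination ih + (l : ℝ) * h

/-- The expectation of the minimum of `l` and the number of good candidates among the first `m`,
computed in two ways. -/
lemma sum_tail (n k m l : ℕ) :
    ∑ y ∈ Finset.Icc 1 l, tail n k m y = truncMean n k m l + l * tail n k m l := by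
  induction l with
  | zero => simp [truncMean]
  | succ l ih =>
    rw [Finset.sum_Icc_succ_top (by omega), ih, truncMean_succ, tail_eq_add n k m l]
    push_cast; ring

/-! ### The numbers `d l x` -/

/-- The closed form of `d` is a rescaled truncated mean, since `(j + 1) * C(k, j + 1) = k * C(k - 1, j)`.
For `l = 1` both sides are `0`, and `d n k 1` is controlled by `d_one_sub` instead. -/
lemma mul_d_eq_truncMean {n k l x : ℕ} (hk : 1 ≤ k) (hl : 1 ≤ l) (hx : x + l ≤ n) :
    (l : ℝ) * (l - 1) * ((x + l).descFactorial l) * d n k l x = truncMean n k (x + l) l := by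
  obtain ⟨b, rfl⟩ : ∃ b, l = b + 1 := ⟨l - 1, by omega⟩
  obtain ⟨c, rfl⟩ : ∃ c, k = c + 1 := ⟨k - 1, by omega⟩
  rcases Nat.eq_zero_or_pos b with rfl | hb
  · simp [truncMean]
  have hb' : (0 : ℝ) < b := by exact_mod_cast hb
  have hf : (x.factorial : ℝ) * ((x + (b + 1)).descFactorial (b + 1)) = (x + (b + 1)).factorial := by
    have := Nat.factorial_mul_descFactorial (show b + 1 ≤ x + (b + 1) by omega)
    rw [Nat.add_sub_cancel] at this
    exact_mod_cast this
  have hc : (n.choose (x + (b + 1)) : ℝ) * (x + (b + 1)).factorial * (n - (b + 1) - x).factorial =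
      n.factorial := by
    have := Nat.choose_mul_factorial_mul_factorial hx
    rw [show n - (x + (b + 1)) = n - (b + 1) - x by omega] at this
    exact_mod_cast this
  have hc0 : (0 : ℝ) < n.choose (x + (b + 1)) := by exact_mod_cast Nat.choose_pos hx
  have hn0 : (0 : ℝ) < n.factorial := by exact_mod_cast n.factorial_pos
  have hs : truncMean n (c + 1) (x + (b + 1)) (b + 1) = ((c : ℝ) + 1) / n.choose (x + (b + 1)) *
      ∑ j ∈ Finset.range b, (c.choose j : ℝ) * ((n - (c + 1)).choose (x + (b + 1) - j - 1) : ℝ) := by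
    rw [truncMean, Finset.sum_range_succ', Finset.mul_sum]
    simp only [Nat.cast_zero, zero_mul, add_zero]
    refine Finset.sum_congr rfl fun j hj => ?_
    rw [Finset.mem_range] at hj
    have h := Nat.add_one_mul_choose_eq c j
    have h' : ((c : ℝ) + 1) * c.choose j = (c + 1).choose (j + 1) * (j + 1) := by exact_mod_cast h
    rw [hyper, if_pos (by omega), show x + (b + 1) - (j + 1) = x + (b + 1) - j - 1 by omega]
    push_cast
    field_simp
    linear_combination -((n - (c + 1)).choose (x + (b + 1) - j - 1) : ℝ) * h'
  rw [hs, d, if_neg (by omega), Nat.add_sub_cancel, Nat.add_sub_cancel, ← hc]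
  rw [← hc] at hn0
  rw [← hf] at hn0 ⊢
  have h1 : (x.factorial : ℝ) ≠ 0 := by positivity
  have h2 : ((n - (b + 1) - x).factorial : ℝ) ≠ 0 := by positivity
  have h3 : (((x + (b + 1)).descFactorial (b + 1) : ℕ) : ℝ) ≠ 0 := fun h => by
    rw [h] at hn0; simp at hn0
  push_cast
  rw [show ((b : ℝ) + 1 - 1) = b by ring]
  field_simp

lemma cast_descFactorial_succ {x l : ℕ} :
    ((x + l).descFactorial (l + 1) : ℝ) = x * (x + l).descFactorial l := by
  rw [Nat.descFactorial_succ, Nat.add_sub_cancel]; push_cast; ring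

lemma cast_succ_descFactorial_succ (m l : ℕ) :
    ((m + 1).descFactorial (l + 1) : ℝ) = (m + 1) * m.descFactorial l := by
  rw [Nat.succ_descFactorial_succ]; push_cast; ring

lemma cast_descFactorial_pos (x l : ℕ) : (0 : ℝ) < (x + l).descFactorial l := by
  exact_mod_cast Nat.descFactorial_pos.2 (Nat.le_add_left l x)

lemma d_one_sub {n k x : ℕ} (hk : 1 ≤ k) (hkn : k ≤ n) (hx : x + 1 + 1 ≤ n) :
    (d n k 1 x - d n k 1 (x + 1)) * ((x + 1 + 1 : ℝ) * (x + 1)) = hyper n k (x + 1 + 1) 1 := by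
  have key : n.choose (x + 2) * (n - (x + 1) - 1).choose (k - 1) * (x + 2) =
      k * n.choose k * (n - k).choose (x + 1) := by
    have h2 := Nat.add_one_mul_choose_eq (n - 1) (x + 1)
    have h3 := Nat.add_one_mul_choose_eq (n - 1) (k - 1)
    rw [show n - 1 + 1 = n by omega] at h2 h3
    rw [Nat.sub_add_cancel hk] at h3
    have h4 : (n - 1).choose (x + 1) * (n - (x + 1) - 1).choose (k - 1) =
        (n - 1).choose (k - 1) * (n - k).choose (x + 1) := by
      rcases le_or_gt (x + 1 + (k - 1)) (n - 1) with h | h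
      · have a1 := Nat.choose_mul (n := n - 1) (show x + 1 ≤ x + 1 + (k - 1) by omega)
        have a2 := Nat.choose_mul (n := n - 1) (show k - 1 ≤ x + 1 + (k - 1) by omega)
        rw [Nat.add_sub_cancel_left] at a1
        rw [Nat.add_sub_cancel] at a2
        rw [show n - (x + 1) - 1 = n - 1 - (x + 1) by omega, ← a1,
          show n - k = n - 1 - (k - 1) by omega, ← a2, Nat.choose_symm_add]
      · rw [Nat.choose_eq_zero_of_lt (show n - (x + 1) - 1 < k - 1 by omega),
          Nat.choose_eq_zero_of_lt (show n - k < x + 1 by omega), mul_zero, mul_zero]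
    calc _ = (n.choose (x + 2) * (x + 2)) * (n - (x + 1) - 1).choose (k - 1) := by ring
      _ = n * ((n - 1).choose (x + 1) * (n - (x + 1) - 1).choose (k - 1)) := by
        rw [← h2]; ring
      _ = (n * (n - 1).choose (k - 1)) * (n - k).choose (x + 1) := by rw [h4]; ring
      _ = _ := by rw [h3]; ring
  have key' : (n.choose (x + 2) : ℝ) * (n - (x + 1) - 1).choose (k - 1) * (x + 2) =
      k * n.choose k * (n - k).choose (x + 1) := by exact_mod_cast key
  have p1 : (0 : ℝ) < n.choose (x + 2) := by exact_mod_cast Nat.choose_pos hx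
  have p2 : (0 : ℝ) < n.choose k := by exact_mod_cast Nat.choose_pos hkn
  rw [d, d, if_pos rfl, if_pos rfl, Finset.sum_Icc_succ_top (by omega), hyper, if_pos (by omega),
    Nat.choose_one_right, show x + 1 + 1 - 1 = x + 1 by omega, show x + 1 + 1 = x + 2 by rfl]
  push_cast
  field_simp
  linear_combination key'

/-- The increments of `d l` in terms of the truncated means. In particular `d l` is
non-increasing. -/
lemma d_sub_d_succ {n k l x : ℕ} (hk : 1 ≤ k) (hkn : k ≤ n) (hl : 1 ≤ l) (hx : x + 1 + l ≤ n) :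
    (l : ℝ) * (d n k l x - d n k l (x + 1)) * (x + 1 + l).descFactorial (l + 1) =
      truncMean n k (x + 1 + l) (l + 1) := by
  rcases hl.eq_or_lt with rfl | h
  · have := d_one_sub hk hkn hx
    rw [cast_descFactorial_succ, Nat.descFactorial_one]
    simp only [truncMean, Finset.sum_range_succ, Finset.sum_range_zero]
    push_cast
    linear_combination this
  · have h1 := mul_d_eq_truncMean (n := n) (x := x) hk hl (by omega)
    have h2 := mul_d_eq_truncMean (n := n) (x := x + 1) hk hl hx
    have h3 := truncMean_backward (n := n) (m := x + l) hkn (by omega) l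
    have h4 : (0 : ℝ) < (l : ℝ) - 1 := by
      have : (1 : ℝ) < l := by exact_mod_cast h
      linarith
    have e1 := cast_descFactorial_succ (x := x + 1) (l := l)
    have e2 := cast_succ_descFactorial_succ (x + l) l
    rw [show x + l + 1 = x + 1 + l by omega] at e2 h3
    apply mul_left_cancel₀ h4.ne'
    rw [truncMean_succ]
    push_cast at *
    linear_combination (x + l + 1 : ℝ) * h1 - (x + 1 : ℝ) * h2 + h3 +
      (l : ℝ) * (l - 1) * d n k l x * e2 - (l : ℝ) * (l - 1) * d n k l (x + 1) * e1

lemma d_succ_le {n k l x : ℕ} (hk : 1 ≤ k) (hkn : k ≤ n) (hl : 1 ≤ l) (hx : x + 1 + l ≤ n) :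
    d n k l (x + 1) ≤ d n k l x := by
  have h := d_sub_d_succ hk hkn hl hx
  have h0 := truncMean_nonneg n k (x + 1 + l) (l + 1)
  have hl' : (0 : ℝ) < l := by exact_mod_cast hl
  have hp : (0 : ℝ) < (x + 1 + l).descFactorial (l + 1) := by
    exact_mod_cast Nat.descFactorial_pos.2 (show l + 1 ≤ x + 1 + l by omega)
  by_contra! hc
  have : (l : ℝ) * (d n k l x - d n k l (x + 1)) * (x + 1 + l).descFactorial (l + 1) < 0 :=
    mul_neg_of_neg_of_pos (mul_neg_of_pos_of_neg hl' (by linarith)) hp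
  linarith

lemma d_anti {n k l x x' : ℕ} (hk : 1 ≤ k) (hkn : k ≤ n) (hl : 1 ≤ l) (hxx : x ≤ x')
    (hx : x' + l ≤ n) : d n k l x' ≤ d n k l x := by
  induction x', hxx using Nat.le_induction with
  | base => exact le_rfl
  | succ a ha ih => exact (d_succ_le hk hkn hl hx).trans (ih (by omega))

/-- Passage from level `l + 1` to level `l` at the same time `x + 1 + l`. -/
lemma d_succ_level {n k l x : ℕ} (hk : 1 ≤ k) (hl : 1 ≤ l) (hx : x + 1 + l ≤ n) :
    (((l : ℝ) + 1) * (x + 1) * d n k (l + 1) x - (l - 1) * d n k l (x + 1)) *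
      (x + 1 + l).descFactorial l = hyper n k (x + 1 + l) l := by
  have h1 := mul_d_eq_truncMean (n := n) (l := l + 1) (x := x) hk (by omega) (by omega)
  have h2 := mul_d_eq_truncMean (n := n) (x := x + 1) hk hl hx
  rw [show x + (l + 1) = x + 1 + l by omega, truncMean_succ, cast_descFactorial_succ] at h1
  have hl' : (0 : ℝ) < l := by exact_mod_cast hl
  apply mul_left_cancel₀ hl'.ne'
  push_cast at *
  linear_combination h1 - h2

/-- The inequality that makes the optimal thresholds non-decreasing. -/
lemma mul_d_succ_le {n k l x : ℕ} (hk : 1 ≤ k) (hkn : k ≤ n) (hl : 1 ≤ l) (hx : x + 1 + l ≤ n) :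
    (l : ℝ) * d n k l (x + 1) ≤ d n k l x + (l + 1) * x * d n k (l + 1) x := by
  have h1 := mul_d_eq_truncMean (n := n) (x := x) hk hl (by omega)
  have h2 := mul_d_eq_truncMean (n := n) (l := l + 1) (x := x) hk (by omega) (by omega)
  have h3 := truncMean_backward (n := n) (m := x + l) hkn (by omega) l
  have h4 := d_sub_d_succ hk hkn hl hx
  have h5 := hyper_nonneg n k (x + 1 + l) l
  have e2 := cast_succ_descFactorial_succ (x + l) l
  have hp := cast_descFactorial_pos x l
  have ht := truncMean_succ n k (x + 1 + l) l
  rw [show x + l + 1 = x + 1 + l by omega] at e2 h3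
  rw [show x + (l + 1) = x + 1 + l by omega] at h2
  rw [e2] at h2 h4
  have hl' : (0 : ℝ) < l := by exact_mod_cast hl
  have hq : (0 : ℝ) < l * ((x + l + 1) * (x + l).descFactorial l) := by positivity
  push_cast at *
  rw [← sub_nonneg]
  refine nonneg_of_mul_nonneg_right ?_ hq
  have : (l : ℝ) * ((x + l + 1) * (x + l).descFactorial l) *
      (d n k l x + (l + 1) * x * d n k (l + 1) x - l * d n k l (x + 1)) =
      (x + 1) * l * hyper n k (x + 1 + l) l := by
    linear_combination x * h2 + l * h4 - (x + l + 1) * h1 - h3 + (x + l) * ht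
  rw [this]; positivity

/-! ### Relative ranks as independent uniform coordinates -/

/-- The rank of candidate `i` among the first `m` arrivals (candidate `i` included if `i < m`). -/
def rankAmong {n : ℕ} (π : Equiv.Perm (Fin n)) (m : ℕ) (i : Fin n) : ℕ :=
  (Finset.univ.filter fun j : Fin n => (j : ℕ) < m ∧ π j ≤ π i).card

lemma relRank_eq_rankAmong {n : ℕ} (π : Equiv.Perm (Fin n)) (i : Fin n) :
    relRank π i = rankAmong π (i + 1) i := by
  simp only [relRank, rankAmong, Fin.le_def, Nat.lt_succ_iff]

lemma relRank_pos {n : ℕ} (π : Equiv.Perm (Fin n)) (i : Fin n) : 1 ≤ relRank π i :=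
  Finset.card_pos.2 ⟨i, by simp⟩

lemma rankAmong_pos {n : ℕ} (π : Equiv.Perm (Fin n)) {m : ℕ} {i : Fin n} (h : (i : ℕ) < m) :
    1 ≤ rankAmong π m i :=
  Finset.card_pos.2 ⟨i, by simp [h]⟩

lemma relRank_le {n : ℕ} (π : Equiv.Perm (Fin n)) (i : Fin n) : relRank π i ≤ i + 1 := by
  have : (Finset.univ.filter fun j : Fin n => j ≤ i ∧ π j ≤ π i) ⊆ Finset.Iic i := fun j hj => by
    simp only [Finset.mem_filter] at hj
    exact Finset.mem_Iic.2 hj.2.1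
  simpa [relRank] using Finset.card_le_card this

lemma rankAmong_end {n : ℕ} (π : Equiv.Perm (Fin n)) (i : Fin n) : rankAmong π n i = π i + 1 := by
  have : (Finset.univ.filter fun j : Fin n => (j : ℕ) < n ∧ π j ≤ π i) =
      (Finset.Iic (π i)).map π.symm.toEmbedding := by
    ext j; simp [Finset.mem_map_equiv]
  rw [rankAmong, this, Finset.card_map, Fin.card_Iic]

/-- A new arrival is better than an earlier candidate exactly if its relative rank does not exceed
the current rank of that candidate. -/
lemma lt_iff_relRank_le {n : ℕ} (π : Equiv.Perm (Fin n)) {i m : Fin n} (h : i < m) :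
    π m < π i ↔ relRank π m ≤ rankAmong π m i := by
  constructor
  -- Replacing `m` by `i` injects the candidates counted on the left into those on the right.
  · intro hlt
    refine Finset.card_le_card_of_injOn (fun j => if j = m then i else j) ?_ ?_
    · intro j hj
      simp only [Finset.coe_filter, Finset.mem_univ, true_and, Set.mem_ofPred_eq] at hj ⊢
      split_ifs with hjm
      · exact ⟨h, le_rfl⟩
      · exact ⟨lt_of_le_of_ne hj.1 (fun e => hjm (Fin.ext e)), hj.2.trans hlt.le⟩
    · intro a ha b hb hab
      simp only [Finset.coe_filter, Finset.mem_univ, true_and, Set.mem_ofPred_eq] at ha hb hab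
      split_ifs at hab with h1 h2 h2
      · rw [h1, h2]
      · exact absurd (hab ▸ hb.2) (not_le.2 hlt)
      · exact absurd (hab ▸ ha.2) (not_le.2 hlt)
      · exact hab
  · intro hle
    by_contra hc
    have hlt : π i < π m := lt_of_le_of_ne (not_lt.1 hc) fun e => h.ne (π.injective e)
    refine absurd hle (not_le.2 (Finset.card_lt_card ?_))
    rw [Finset.ssubset_iff_of_subset]
    · exact ⟨m, by simp, by simp⟩
    · intro j hj
      simp only [Finset.mem_filter, Finset.mem_univ, true_and] at hj ⊢
      exact ⟨(show j < m from hj.1).le, hj.2.trans hlt.le⟩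

lemma rankAmong_succ {n : ℕ} (π : Equiv.Perm (Fin n)) {i m : Fin n} (h : i < m) :
    rankAmong π (m + 1) i =
      if relRank π m ≤ rankAmong π m i then rankAmong π m i + 1 else rankAmong π m i := by
  have hne : π m ≠ π i := fun e => h.ne (π.injective e).symm
  split_ifs with hc
  · have hlt := (lt_iff_relRank_le π h).2 hc
    have : (Finset.univ.filter fun j : Fin n => (j : ℕ) < m + 1 ∧ π j ≤ π i) =
        insert m (Finset.univ.filter fun j : Fin n => (j : ℕ) < m ∧ π j ≤ π i) := by
      ext j
      simp only [Finset.mem_filter, Finset.mem_univ, true_and, Finset.mem_insert,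
        Nat.lt_succ_iff_lt_or_eq, ← Fin.ext_iff]
      constructor
      · rintro ⟨h1 | h1, h2⟩
        · exact Or.inr ⟨h1, h2⟩
        · exact Or.inl h1
      · rintro (h1 | ⟨h1, h2⟩)
        · exact ⟨Or.inr h1, h1 ▸ hlt.le⟩
        · exact ⟨Or.inl h1, h2⟩
    rw [rankAmong, this, Finset.card_insert_of_notMem (by simp)]; rfl
  · have hlt : ¬ π m ≤ π i := fun e => hc ((lt_iff_relRank_le π h).1 (lt_of_le_of_ne e hne))
    unfold rankAmong
    congr 1
    ext j
    simp only [Finset.mem_filter, Finset.mem_univ, true_and, Nat.lt_succ_iff_lt_or_eq, ← Fin.ext_iff]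
    constructor
    · rintro ⟨h1 | h1, h2⟩
      · exact ⟨h1, h2⟩
      · exact absurd (h1 ▸ h2) hlt
    · rintro ⟨h1, h2⟩
      exact ⟨Or.inl h1, h2⟩

/-- The relative ranks of all candidates, each lowered by `1` so that candidate `i` contributes an
element of `Fin (i + 1)` (the Lehmer code of the ordering). -/
def code {n : ℕ} (π : Equiv.Perm (Fin n)) (i : Fin n) : Fin (i + 1) :=
  ⟨relRank π i - 1, by have := relRank_le π i; have := relRank_pos π i; omega⟩

lemma code_val_add_one {n : ℕ} (π : Equiv.Perm (Fin n)) (i : Fin n) :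
    (code π i : ℕ) + 1 = relRank π i := Nat.sub_add_cancel (relRank_pos π i)

lemma code_injective (n : ℕ) :
    Function.Injective (code : Equiv.Perm (Fin n) → (i : Fin n) → Fin (i + 1)) := by
  intro π ρ h
  have hr : ∀ i, relRank π i = relRank ρ i := fun i => by
    rw [← code_val_add_one, ← code_val_add_one, h]
  have hz : ∀ m, m ≤ n → ∀ i : Fin n, (i : ℕ) < m → rankAmong π m i = rankAmong ρ m i := by
    intro m
    induction m with
    | zero => intro _ i hi; omega
    | succ m ih =>
      intro hm i hi
      rcases Nat.lt_succ_iff_lt_or_eq.1 hi with h1 | h1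
      · have h2 : i < (⟨m, hm⟩ : Fin n) := h1
        have e1 := rankAmong_succ π h2
        have e2 := rankAmong_succ ρ h2
        simp only at e1 e2
        rw [e1, e2, ih (by omega) i h1, hr]
      · subst h1
        rw [← relRank_eq_rankAmong, ← relRank_eq_rankAmong, hr]
  ext i
  have := hz n le_rfl i i.2
  rw [rankAmong_end, rankAmong_end] at this
  omega

lemma card_codes (n : ℕ) : Fintype.card ((i : Fin n) → Fin (i + 1)) = n.factorial := by
  rw [Fintype.card_pi]
  simp only [Fintype.card_fin]
  rw [Fin.prod_univ_eq_prod_range (fun i => i + 1) n, Finset.prod_range_add_one_eq_factorial]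

lemma code_bijective (n : ℕ) :
    Function.Bijective (code : Equiv.Perm (Fin n) → (i : Fin n) → Fin (i + 1)) := by
  rw [Fintype.bijective_iff_injective_and_card, card_codes, Fintype.card_perm, Fintype.card_fin]
  exact ⟨code_injective n, rfl⟩

/-- A code as a sequence of relative ranks: the value at time `j + 1` is the relative rank of
candidate `j`, with the value `0` beyond the last candidate. -/
def rankSeq {n : ℕ} (r : (i : Fin n) → Fin (i + 1)) (j : ℕ) : ℕ :=
  if h : j < n then (r ⟨j, h⟩ : ℕ) + 1 else 0

lemma rankSeq_code {n : ℕ} (π : Equiv.Perm (Fin n)) (i : Fin n) :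
    rankSeq (code π) i = relRank π i := by
  simp [rankSeq, code_val_add_one]

lemma rankSeq_le {n : ℕ} (r : (i : Fin n) → Fin (i + 1)) (j : ℕ) : rankSeq r j ≤ j + 1 := by
  unfold rankSeq
  split_ifs with h
  · exact (r ⟨j, h⟩).2
  · omega

/-- Averaging over one coordinate does not change the total. -/
lemma sum_sum_update {ι : Type*} [Fintype ι] [DecidableEq ι] {β : ι → Type*} [∀ i, Fintype (β i)]
    (F : (∀ i, β i) → ℝ) (j : ι) :
    ∑ r, ∑ y, F (Function.update r j y) = Fintype.card (β j) * ∑ r, F r := by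
  have h : ∑ r, ∑ y, F (Function.update r j y) = ∑ r, ∑ _y : β j, F r := by
    rw [← Fintype.sum_prod_type', ← Fintype.sum_prod_type']
    have hinv : Function.Involutive
        (fun p : (∀ i, β i) × β j => (Function.update p.1 j p.2, p.1 j)) := fun p => by simp
    exact Fintype.sum_equiv hinv.toPerm _ _ fun p => rfl
  rw [h]
  simp [Finset.mul_sum]

/-! ### The success probability by backward induction -/

/-- The state, after `m` arrivals with relative ranks `a`, of the policy that accepts at time `m`
every relative rank at most `L m`: it is `0` if nobody has been accepted, and otherwise the current
rank of the accepted candidate among the first `m`. -/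
def track (L a : ℕ → ℕ) : ℕ → ℕ
  | 0 => 0
  | m + 1 =>
    if track L a m = 0 then (if a m ≤ L (m + 1) then a m else 0)
    else (if a m ≤ track L a m then track L a m + 1 else track L a m)

lemma track_congr {L a b : ℕ → ℕ} {m : ℕ} (h : ∀ j, j < m → a j = b j) :
    track L a m = track L b m := by
  induction m with
  | zero => rfl
  | succ m ih => rw [track, track, ih fun j hj => h j (by omega), h m (by omega)]

lemma track_le {L a : ℕ → ℕ} (h : ∀ j, a j ≤ j + 1) (m : ℕ) : track L a m ≤ m := by
  induction m with
  | zero => exact le_rfl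
  | succ m ih =>
    have := h m
    rw [track]
    split_ifs <;> omega

/-- The probability of success in the future, when `j` candidates are still to come and nobody has
been accepted, of the policy that accepts at time `m` every relative rank at most `L m`. Accepting
nobody counts as a failure. -/
noncomputable def valueToGo (n k : ℕ) (L : ℕ → ℕ) : ℕ → ℝ
  | 0 => 0
  | j + 1 => (∑ y ∈ Finset.Icc 1 (n - j),
      if y ≤ L (n - j) then tail n k (n - j) y else valueToGo n k L j) / ((n - j : ℕ) : ℝ)

/-- The same probability, indexed by the number `m` of candidates met so far. -/
noncomputable def value (n k : ℕ) (L : ℕ → ℕ) (m : ℕ) : ℝ := valueToGo n k L (n - m)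

lemma value_end (n k : ℕ) (L : ℕ → ℕ) : value n k L n = 0 := by simp [value, valueToGo]

lemma mul_value {n k : ℕ} (L : ℕ → ℕ) {m : ℕ} (h : m < n) :
    ((m : ℝ) + 1) * value n k L m = ∑ y ∈ Finset.Icc 1 (m + 1),
      if y ≤ L (m + 1) then tail n k (m + 1) y else value n k L (m + 1) := by
  rw [value, show n - m = (n - (m + 1)) + 1 by omega, valueToGo,
    show n - (n - (m + 1)) = m + 1 by omega]
  have : ((m : ℝ) + 1) ≠ 0 := by positivity
  push_cast
  rw [mul_div_cancel₀ _ this]; rfl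

lemma sum_Icc_ite_le {N l : ℕ} (h : l ≤ N) (f : ℕ → ℝ) (c : ℝ) :
    ∑ y ∈ Finset.Icc 1 N, (if y ≤ l then f y else c) =
      ∑ y ∈ Finset.Icc 1 l, f y + ((N : ℝ) - l) * c := by
  induction N, h using Nat.le_induction with
  | base =>
    rw [sub_self, zero_mul, add_zero]
    exact Finset.sum_congr rfl fun y hy => if_pos (Finset.mem_Icc.1 hy).2
  | succ N hN ih =>
    rw [Finset.sum_Icc_succ_top (by omega), ih, if_neg (by omega)]
    push_cast; ring

/-- The conditional probability of success after `m` arrivals, as a function of the state. -/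
noncomputable def stateValue (n k : ℕ) (L : ℕ → ℕ) (m z : ℕ) : ℝ :=
  if z = 0 then value n k L m else tail n k m z

/-- The state value is a martingale: averaging over the relative rank of the next arrival gives the
present state value. -/
lemma sum_stateValue_update {n k m : ℕ} (hk : k ≤ n) (L : ℕ → ℕ) (hm : m < n)
    (r : (i : Fin n) → Fin (i + 1)) :
    ∑ y : Fin (m + 1), stateValue n k L (m + 1)
        (track L (rankSeq (Function.update r ⟨m, hm⟩ y)) (m + 1)) =
      ((m : ℝ) + 1) * stateValue n k L m (track L (rankSeq r) m) := by
  have h1 : ∀ y : Fin (m + 1),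
      track L (rankSeq (Function.update r ⟨m, hm⟩ y)) m = track L (rankSeq r) m := fun y =>
    track_congr fun j hj => by
      unfold rankSeq
      split_ifs with h
      · rw [Function.update_of_ne (by simp [Fin.ext_iff]; omega)]
      · rfl
  have h2 : ∀ y : Fin (m + 1), rankSeq (Function.update r ⟨m, hm⟩ y) m = y + 1 := fun y => by
    simp [rankSeq, hm]
  have hz := track_le (L := L) (rankSeq_le r) m
  simp only [track, h1, h2]
  generalize track L (rankSeq r) m = z at *
  rw [Fin.sum_univ_eq_sum_range (fun y => stateValue n k L (m + 1)
    (if z = 0 then (if y + 1 ≤ L (m + 1) then y + 1 else 0)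
      else (if y + 1 ≤ z then z + 1 else z))) (m + 1)]
  have hshift : ∀ f : ℕ → ℝ, ∑ y ∈ Finset.range (m + 1), f (y + 1) =
      ∑ y ∈ Finset.Icc 1 (m + 1), f y := fun f => by
      rw [Finset.range_eq_Ico, Finset.sum_Ico_add' f 0 (m + 1) 1]; rfl
  rw [hshift (fun y => stateValue n k L (m + 1)
    (if z = 0 then (if y ≤ L (m + 1) then y else 0) else (if y ≤ z then z + 1 else z)))]
  rcases Nat.eq_zero_or_pos z with rfl | hz0
  · simp only [if_true, stateValue]
    rw [mul_value L hm]
    refine Finset.sum_congr rfl fun y hy => ?_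
    have := (Finset.mem_Icc.1 hy).1
    split_ifs <;> first | rfl | omega
  · have e : ∀ y, stateValue n k L (m + 1)
        (if z = 0 then (if y ≤ L (m + 1) then y else 0) else (if y ≤ z then z + 1 else z)) =
        if y ≤ z then tail n k (m + 1) (z + 1) else tail n k (m + 1) z := fun y => by
      by_cases hy : y ≤ z <;> simp [stateValue, hz0.ne', hy]
    simp only [e]
    rw [sum_Icc_ite_le (by omega), stateValue, if_neg hz0.ne', Finset.sum_const, Nat.card_Icc]
    have h3 := tail_succ_sub hk hm z
    have h4 := tail_eq_add n k (m + 1) z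
    simp only [nsmul_eq_mul]
    push_cast
    linear_combination (-(z : ℝ)) * h4 + h3

lemma sum_stateValue {n k : ℕ} (hk : k ≤ n) (L : ℕ → ℕ) {m : ℕ} (hm : m ≤ n) :
    ∑ r : (i : Fin n) → Fin (i + 1), stateValue n k L m (track L (rankSeq r) m) =
      n.factorial * value n k L 0 := by
  induction m with
  | zero => simp [track, stateValue, ← card_codes n]
  | succ m ih =>
    have h := sum_sum_update (fun r : (i : Fin n) → Fin (i + 1) =>
      stateValue n k L (m + 1) (track L (rankSeq r) (m + 1))) ⟨m, hm⟩
    simp only [Fintype.card_fin] at h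
    rw [Finset.sum_congr rfl fun r _ => sum_stateValue_update hk L hm r, ← Finset.mul_sum,
      ih (by omega)] at h
    have : ((m : ℝ) + 1) ≠ 0 := by positivity
    push_cast at h
    exact (mul_left_cancel₀ this h).symm

/-- Along an actual ordering, the state is `0` until the first acceptance, and then the current rank
of the candidate accepted first. -/
lemma track_code {n : ℕ} (L : ℕ → ℕ) (π : Equiv.Perm (Fin n)) {m : ℕ} (hm : m ≤ n) :
    (track L (rankSeq (code π)) m = 0 ∧ ∀ j : Fin n, (j : ℕ) < m → ¬ relRank π j ≤ L (j + 1)) ∨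
      ∃ i : Fin n, (i : ℕ) < m ∧ relRank π i ≤ L (i + 1) ∧
        (∀ j, j < i → ¬ relRank π j ≤ L (j + 1)) ∧
        track L (rankSeq (code π)) m = rankAmong π m i := by
  induction m with
  | zero => exact Or.inl ⟨rfl, fun j hj => by omega⟩
  | succ m ih =>
    have hrm : rankSeq (code π) m = relRank π ⟨m, hm⟩ := rankSeq_code π ⟨m, hm⟩
    rcases ih (by omega) with ⟨h0, hn⟩ | ⟨i, him, hi, hfirst, ht⟩
    · rw [track, if_pos h0, hrm]
      by_cases hc : relRank π ⟨m, hm⟩ ≤ L (m + 1)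
      · refine Or.inr ⟨⟨m, hm⟩, Nat.lt_succ_self m, hc, fun j hj => hn j hj, ?_⟩
        rw [if_pos hc, relRank_eq_rankAmong]
      · refine Or.inl ⟨if_neg hc, fun j hj => ?_⟩
        rcases Nat.lt_succ_iff_lt_or_eq.1 hj with h | h
        · exact hn j h
        · have : j = ⟨m, hm⟩ := Fin.ext h
          subst this; exact hc
    · refine Or.inr ⟨i, by omega, hi, hfirst, ?_⟩
      have hpos := rankAmong_pos π him
      have e := rankAmong_succ π (show i < (⟨m, hm⟩ : Fin n) from him)
      simp only at e
      rw [track, ht, if_neg (by omega), hrm, e]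

/-- The number of thresholds that have been passed before time `i`, that is, the largest relative
rank that the threshold policy accepts at this time. -/
def level (k : ℕ) (s : ℕ → ℕ) (i : ℕ) : ℕ := ((Finset.Icc 1 k).filter fun l => s l < i).card

lemma level_le (k : ℕ) (s : ℕ → ℕ) (i : ℕ) : level k s i ≤ k := by
  simpa [level] using Finset.card_filter_le (Finset.Icc 1 k) fun l => s l < i

/-- The thresholds below `i` are exactly `s 1, …, s (level k s i)`, as `s` is non-decreasing. -/
lemma lt_iff_le_level {n k : ℕ} {s : ℕ → ℕ} (hs : IsAdmissible n k s) {l i : ℕ} (h1 : 1 ≤ l)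
    (h2 : l ≤ k) : s l < i ↔ l ≤ level k s i := by
  constructor
  · intro h
    have : Finset.Icc 1 l ⊆ (Finset.Icc 1 k).filter fun l => s l < i := fun a ha => by
      rw [Finset.mem_Icc] at ha
      rw [Finset.mem_filter, Finset.mem_Icc]
      exact ⟨⟨ha.1, ha.2.trans h2⟩, (hs.2 a l ha.1 ha.2 h2).trans_lt h⟩
    simpa [level] using Finset.card_le_card this
  · intro h
    by_contra hc
    have : ((Finset.Icc 1 k).filter fun l => s l < i) ⊆ Finset.Icc 1 (l - 1) := fun a ha => by
      rw [Finset.mem_filter, Finset.mem_Icc] at ha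
      rw [Finset.mem_Icc]
      refine ⟨ha.1.1, ?_⟩
      by_contra hal
      have := hs.2 l a h1 (by omega) ha.1.2
      omega
    have := Finset.card_le_card this
    rw [Nat.card_Icc] at this
    unfold level at h
    omega

lemma level_end {n k : ℕ} {s : ℕ → ℕ} (hs : IsAdmissible n k s) : level k s n = k := by
  refine le_antisymm (level_le _ _ _) ?_
  rcases Nat.eq_zero_or_pos k with rfl | hk
  · exact Nat.zero_le _
  · exact (lt_iff_le_level hs hk le_rfl).1 (hs.1 k hk le_rfl).2

lemma acceptable_iff {n k : ℕ} {s : ℕ → ℕ} (hs : IsAdmissible n k s) (π : Equiv.Perm (Fin n))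
    (i : Fin n) :
    Acceptable k s π i ↔ (i : ℕ) + 1 < n ∧ relRank π i ≤ level k s (i + 1) := by
  have hi := i.2
  constructor
  · rintro ⟨l, h1, h2, h3, h4, h5⟩
    refine ⟨?_, h5.trans ((lt_iff_le_level hs h1 h2).1 h3)⟩
    unfold extend at h4
    split_ifs at h4 with h
    · exact h4.trans_lt (hs.1 (l + 1) (by omega) h).2
    · omega
  · rintro ⟨h1, h2⟩
    have h3 := relRank_pos π i
    have h4 := level_le k s (i + 1)
    refine ⟨_, h3.trans h2, h4, (lt_iff_le_level hs (h3.trans h2) h4).2 le_rfl, ?_, h2⟩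
    unfold extend
    split_ifs with h
    · by_contra hc
      have := (lt_iff_le_level hs (by omega) h).1 (not_le.1 hc)
      omega
    · omega

/-- At time `n` the level is `k`, so the forced choice of the last candidate may be replaced by the
rule to accept it if and only if it is one of the `k` best. -/
lemma succeeds_iff {n k : ℕ} {s : ℕ → ℕ} (hs : IsAdmissible n k s) (π : Equiv.Perm (Fin n)) :
    Succeeds k s π ↔ ∃ i : Fin n, relRank π i ≤ level k s (i + 1) ∧
      (∀ j, j < i → ¬ relRank π j ≤ level k s (j + 1)) ∧ (π i : ℕ) + 1 ≤ k := by
  have hlast : ∀ i : Fin n, (i : ℕ) + 1 = n →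
      (relRank π i ≤ level k s (i + 1) ↔ (π i : ℕ) + 1 ≤ k) := fun i hi => by
    rw [relRank_eq_rankAmong, hi, level_end hs, rankAmong_end]
  simp only [Succeeds, Chooses, acceptable_iff hs]
  constructor
  · rintro ⟨i, ⟨⟨-, h2⟩, h3⟩ | ⟨h1, h2⟩, h4⟩
    · refine ⟨i, h2, fun j hj hc => h3 j hj ⟨?_, hc⟩, h4⟩
      have := i.2
      have : (j : ℕ) < i := hj
      omega
    · refine ⟨i, (hlast i h2).2 h4, fun j hj hc => h1 j ⟨?_, hc⟩, h4⟩
      have : (j : ℕ) < i := hj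
      omega
  · rintro ⟨i, h1, h2, h3⟩
    refine ⟨i, ?_, h3⟩
    have hi := i.2
    rcases Nat.lt_or_ge ((i : ℕ) + 1) n with h | h
    · exact Or.inl ⟨⟨h, h1⟩, fun j hj hc => h2 j hj hc.2⟩
    · refine Or.inr ⟨fun j hc => h2 j ?_ hc.2, by omega⟩
      exact Fin.lt_def.2 (by omega)

lemma stateValue_track_code {n k : ℕ} (hk : k ≤ n) {s : ℕ → ℕ} (hs : IsAdmissible n k s)
    (π : Equiv.Perm (Fin n)) [Decidable (Succeeds k s π)] :
    stateValue n k (level k s) n (track (level k s) (rankSeq (code π)) n) =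
      if Succeeds k s π then 1 else 0 := by
  simp only [succeeds_iff hs]
  rcases track_code (level k s) π le_rfl with ⟨h0, hn⟩ | ⟨i, -, hi, hfirst, ht⟩
  · rw [h0, stateValue, if_pos rfl, value_end, if_neg]
    rintro ⟨i, h1, -⟩
    exact hn i i.2 h1
  · rw [ht, rankAmong_end, stateValue, if_neg (by omega), tail_end hk]
    refine if_congr ⟨fun h => ⟨i, hi, hfirst, h⟩, ?_⟩ rfl rfl
    rintro ⟨i', h1, h2, h3⟩
    have : i' = i := le_antisymm (not_lt.1 fun h => h2 i h hi) (not_lt.1 fun h => hfirst i' h h1)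
    rwa [this] at h3

open Classical in
lemma successProb_eq_value {n k : ℕ} (hk : k ≤ n) {s : ℕ → ℕ} (hs : IsAdmissible n k s) :
    successProb n k s = value n k (level k s) 0 := by
  have h := sum_stateValue hk (level k s) (le_refl n)
  rw [← (Equiv.ofBijective code (code_bijective n)).sum_comp] at h
  simp only [Equiv.ofBijective_apply, stateValue_track_code hk hs] at h
  rw [Finset.sum_boole] at h
  have hf : (n.factorial : ℝ) ≠ 0 := by positivity
  rw [successProb, h, mul_div_cancel_left₀ _ hf]

/-! ### The recursion for the thresholds -/

lemma rhs_congr {n k : ℕ} {t t' : ℕ → ℕ} {l : ℕ} (h : ∀ j, l < j → t j = t' j) :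
    rhs n k t l = rhs n k t' l := by
  have hp : ∀ i, ∏ j ∈ Finset.Icc (l + 1) i, (t j : ℝ) = ∏ j ∈ Finset.Icc (l + 1) i, (t' j : ℝ) :=
    fun i => Finset.prod_congr rfl fun j hj => by rw [h j (Finset.mem_Icc.1 hj).1]
  unfold rhs
  rw [hp k]
  congr 2
  exact Finset.sum_congr rfl fun i hi => by
    rw [hp i, h (i + 1) (Nat.lt_succ_of_le (Finset.mem_Ico.1 hi).1)]

lemma mul_rhs {n k : ℕ} (t : ℕ → ℕ) {l : ℕ} (hl : 1 ≤ l) (hlk : l < k) :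
    (l : ℝ) * rhs n k t l =
      d n k l (t (l + 1)) + (l + 1) * t (l + 1) * rhs n k t (l + 1) := by
  have hp : ∀ i, l + 1 ≤ i → ∏ j ∈ Finset.Icc (l + 1) i, (t j : ℝ) =
      t (l + 1) * ∏ j ∈ Finset.Icc (l + 1 + 1) i, (t j : ℝ) := fun i hi => by
    rw [← Finset.insert_Icc_succ_left_eq_Icc hi, Finset.prod_insert (by simp)]; rfl
  have h1 : (l : ℝ) ≠ 0 := by
    have : (0 : ℝ) < l := by exact_mod_cast hl
    exact this.ne'
  have h2 : (l : ℝ) + 1 ≠ 0 := by positivity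
  unfold rhs
  rw [Finset.sum_eq_sum_Ico_succ_bot hlk, hp k hlk,
    Finset.sum_congr rfl fun i hi => by rw [hp i (Finset.mem_Ico.1 hi).1, mul_assoc],
    ← Finset.mul_sum]
  simp only [Finset.Icc_eq_empty_of_lt (Nat.lt_succ_self l), Finset.prod_empty]
  push_cast
  field_simp
  ring

/-- The boundary value at level `k` and time `n`, where the remaining value is `0`. -/
lemma top_rhs {n k : ℕ} (hk : 1 ≤ k) (hkn : k < n) (t : ℕ → ℕ) :
    (n.descFactorial k : ℝ) * (k * (rhs n k t k - d n k k (n - k))) = 1 := by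
  have hk' : (0 : ℝ) < k := by exact_mod_cast hk
  have hr : rhs n k t k = delta k n / k := by
    simp [rhs, div_eq_inv_mul]
  rw [hr]
  rcases hk.eq_or_lt with rfl | h
  · have hn : (0 : ℝ) < n := by exact_mod_cast (show 0 < n by omega)
    have hs : ∑ j ∈ Finset.Icc 1 (n - 1), ((n - j - 1).choose (1 - 1) : ℝ) / (j : ℝ) =
        ∑ j ∈ Finset.Icc 1 (n - 1), 1 / (j : ℝ) := by simp
    rw [d, delta, if_pos rfl, if_pos rfl, hs, Nat.descFactorial_one, Nat.choose_one_right]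
    field_simp
    push_cast
    ring
  · have h1 := mul_d_eq_truncMean (n := n) (x := n - k) hk hk (by omega)
    rw [Nat.sub_add_cancel hkn.le] at h1
    have h2 : truncMean n k n k = 0 := Finset.sum_eq_zero fun j hj => by
      rw [hyper_end hkn.le, if_neg (Finset.mem_range.1 hj).ne, mul_zero]
    have h3 : ((n - k).factorial : ℝ) * n.descFactorial k = n.factorial := by
      exact_mod_cast Nat.factorial_mul_descFactorial hkn.le
    have h4 : (1 : ℝ) < k := by exact_mod_cast h
    have h5 : (0 : ℝ) < n.factorial := by exact_mod_cast n.factorial_pos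
    have h6 : (n.descFactorial k : ℝ) ≠ 0 := fun e => by rw [e] at h3; linarith
    have h7 : d n k k (n - k) = 0 := by
      rw [h2] at h1
      exact (mul_eq_zero.1 h1).resolve_left
        (mul_ne_zero (mul_ne_zero hk'.ne' (by linarith)) h6)
    rw [h7, delta, if_neg (by omega)]
    field_simp
    linarith

/-- The threshold at level `l` exceeds the one at level `l + 1` by at most `1`, since `t (l + 1) + 1`
satisfies the inequality at level `l`. -/
lemma d_le_rhs_of_succ {n k : ℕ} (hk : 1 ≤ k) (hkn : k ≤ n) {t : ℕ → ℕ} {l : ℕ} (hl : 1 ≤ l)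
    (hlk : l < k) (hx : t (l + 1) + 1 + l ≤ n)
    (h : d n k (l + 1) (t (l + 1)) ≤ rhs n k t (l + 1)) :
    d n k l (t (l + 1) + 1) ≤ rhs n k t l := by
  have h1 := mul_d_succ_le hk hkn hl hx
  have h2 := mul_rhs (n := n) t hl hlk
  have hl' : (0 : ℝ) < l := by exact_mod_cast hl
  have h3 := mul_le_mul_of_nonneg_left h (show (0 : ℝ) ≤ (l + 1) * t (l + 1) by positivity)
  exact le_of_mul_le_mul_left (by linarith) hl'

lemma exists_isThresholdSystem {n k : ℕ} (hk : 1 ≤ k) (hkn : k < n) :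
    ∃ t, IsThresholdSystem n k t := by
  suffices H : ∀ m, ∃ t : ℕ → ℕ, ∀ l, 1 ≤ l → l ≤ k → k < l + m →
      IsLeast {x : ℕ | 1 ≤ x ∧ x ≤ n - l ∧ d n k l x ≤ rhs n k t l} (t l) by
    obtain ⟨t, ht⟩ := H k
    exact ⟨t, fun l h1 h2 => ht l h1 h2 (by omega)⟩
  intro m
  induction m with
  | zero => exact ⟨0, fun l _ h2 h3 => by omega⟩
  | succ m ih =>
    obtain ⟨t, ht⟩ := ih
    rcases Nat.lt_or_ge m k with hm | hm
    swap
    · exact ⟨t, fun l h1 h2 h3 => ht l h1 h2 (by omega)⟩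
    obtain ⟨l₀, hl₀⟩ : ∃ l₀, k = l₀ + m := ⟨k - m, by omega⟩
    have hne : {x : ℕ | 1 ≤ x ∧ x ≤ n - l₀ ∧ d n k l₀ x ≤ rhs n k t l₀}.Nonempty := by
      rcases Nat.eq_zero_or_pos m with rfl | hm0
      · obtain rfl : k = l₀ := hl₀
        refine ⟨n - k, by omega, le_rfl, ?_⟩
        have h1 := top_rhs hk hkn t
        have hk' : (0 : ℝ) < k := by exact_mod_cast hk
        by_contra! hc
        have h2 : (n.descFactorial k : ℝ) * (k * (rhs n k t k - d n k k (n - k))) ≤ 0 :=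
          mul_nonpos_of_nonneg_of_nonpos (by positivity)
            (mul_nonpos_of_nonneg_of_nonpos hk'.le (by linarith))
        linarith
      · obtain ⟨h1, h2, h3⟩ := (ht (l₀ + 1) (by omega) (by omega) (by omega)).1
        exact ⟨t (l₀ + 1) + 1, by omega, by omega,
          d_le_rhs_of_succ hk hkn.le (by omega) (by omega) (by omega) h3⟩
    refine ⟨Function.update t l₀
      (sInf {x : ℕ | 1 ≤ x ∧ x ≤ n - l₀ ∧ d n k l₀ x ≤ rhs n k t l₀}), fun l h1 h2 h3 => ?_⟩
    have hr : ∀ l, l₀ ≤ l → rhs n k (Function.update t l₀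
        (sInf {x : ℕ | 1 ≤ x ∧ x ≤ n - l₀ ∧ d n k l₀ x ≤ rhs n k t l₀})) l = rhs n k t l :=
      fun l hl => rhs_congr fun j hj => Function.update_of_ne (by omega) _ _
    rw [hr l (by omega)]
    rcases eq_or_ne l l₀ with rfl | hne'
    · rw [Function.update_self]
      exact ⟨Nat.sInf_mem hne, fun x hx => Nat.sInf_le hx⟩
    · rw [Function.update_of_ne hne']
      exact ht l h1 h2 (by omega)

namespace IsThresholdSystem

variable {n k : ℕ} {t : ℕ → ℕ}

lemma le_succ (ht : IsThresholdSystem n k t) (hkn : k < n) {l : ℕ} (hl : 1 ≤ l) (hlk : l < k) :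
    t l ≤ t (l + 1) + 1 := by
  obtain ⟨h1, h2, h3⟩ := (ht (l + 1) (by omega) hlk).1
  exact (ht l hl hlk.le).2 ⟨by omega, by omega,
    d_le_rhs_of_succ (by omega) hkn.le hl hlk (by omega) h3⟩

lemma isAdmissible (ht : IsThresholdSystem n k t) (hkn : k < n) :
    IsAdmissible n k (fun l => t l + l - 1) := by
  refine ⟨fun l h1 h2 => ?_, fun l m h1 h2 => ?_⟩
  · obtain ⟨a, b, -⟩ := (ht l h1 h2).1
    simp only
    omega
  · induction m, h2 using Nat.le_induction with
    | base => exact fun _ => le_rfl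
    | succ m hm ih =>
      intro h3
      have a := ih (by omega)
      have b := ht.le_succ hkn (show 1 ≤ m by omega) h3
      simp only at a ⊢
      omega

end IsThresholdSystem

/-! ### The value of the threshold policy -/

/-- One step back in time, inside the period in which relative ranks up to `l` are accepted. -/
lemma tail_sub_value_step {n k : ℕ} {L : ℕ → ℕ} {l x : ℕ} {R : ℝ} (hk : 1 ≤ k) (hkn : k ≤ n)
    (hl : 1 ≤ l) (hx : x + 1 + l ≤ n) (hL : L (x + 1 + l) = l)
    (h : tail n k (x + 1 + l) l - value n k L (x + 1 + l) =
      (x + 1 + l).descFactorial l * (l * (R - d n k l (x + 1)))) :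
    tail n k (x + l) l - value n k L (x + l) =
      (x + l).descFactorial l * (l * (R - d n k l x)) := by
  have e : x + l + 1 = x + 1 + l := by omega
  have h1 := mul_value (k := k) L (show x + l < n by omega)
  have h2 := tail_succ_sub hkn (show x + l < n by omega) l
  have h3 := d_sub_d_succ hk hkn hl hx
  have e1 := cast_descFactorial_succ (x := x + 1) (l := l)
  have e2 := cast_succ_descFactorial_succ (x + l) l
  have h4 := truncMean_succ n k (x + 1 + l) l
  rw [e] at h1 h2 e2
  rw [hL, sum_Icc_ite_le (by omega), sum_tail] at h1
  have hp : (0 : ℝ) < (x : ℝ) + l + 1 := by positivity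
  apply mul_left_cancel₀ hp.ne'
  push_cast at *
  linear_combination (x + 1 : ℝ) * h - h1 - h2 + h3 + h4 +
    l * (R - d n k l x) * e2 - l * (R - d n k l (x + 1)) * e1

lemma value_nonneg (n k : ℕ) (L : ℕ → ℕ) (m : ℕ) : 0 ≤ value n k L m := by
  unfold value
  induction n - m with
  | zero => exact le_rfl
  | succ j ih =>
    refine div_nonneg (Finset.sum_nonneg fun y _ => ?_) (Nat.cast_nonneg _)
    split_ifs
    · exact tail_nonneg _ _ _ _
    · exact ih

/-- With one candidate left and nobody accepted, the forced choice succeeds with probability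
`k / n`. -/
lemma value_pred {n k : ℕ} {L : ℕ → ℕ} (hkn : k < n) (hL : L n = k) :
    value n k L (n - 1) = (k : ℝ) / n := by
  have h := mul_value (k := k) L (show n - 1 < n by omega)
  have e : n - 1 + 1 = n := by omega
  have e' : ((n - 1 : ℕ) : ℝ) + 1 = n := by exact_mod_cast e
  have hn : (0 : ℝ) < n := by exact_mod_cast (show 0 < n by omega)
  rw [e, e', hL, sum_Icc_ite_le hkn.le, value_end, mul_zero, add_zero,
    Finset.sum_congr rfl fun y hy => by rw [tail_end hkn.le, if_pos (Finset.mem_Icc.1 hy).2]] at h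
  rw [eq_div_iff hn.ne', mul_comm, h]
  simp

/-- At time `i` the level function `L` prescribes the better of stopping and continuing, for every
possible relative rank. -/
def IsGreedyAt (n k : ℕ) (L : ℕ → ℕ) (i : ℕ) : Prop :=
  ∀ y, 1 ≤ y → (y ≤ L i → value n k L i ≤ tail n k i y) ∧ (L i < y → tail n k i y ≤ value n k L i)

lemma IsGreedyAt.value_succ_le {n k : ℕ} {L : ℕ → ℕ} {m : ℕ} (h : IsGreedyAt n k L (m + 1))
    (hm : m < n) : value n k L (m + 1) ≤ value n k L m := by
  have h1 := mul_value (k := k) L hm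
  have h2 : ∑ _y ∈ Finset.Icc 1 (m + 1), value n k L (m + 1) ≤ ((m : ℝ) + 1) * value n k L m := by
    rw [h1]
    refine Finset.sum_le_sum fun y hy1 => ?_
    split_ifs with hy
    · exact (h y (Finset.mem_Icc.1 hy1).1).1 hy
    · exact le_rfl
  rw [Finset.sum_const, Nat.card_Icc, nsmul_eq_mul, Nat.add_sub_cancel] at h2
  push_cast at h2
  exact le_of_mul_le_mul_left h2 (by positivity)

lemma value_le_of_isGreedyAt {n k : ℕ} {L : ℕ → ℕ} {i m : ℕ} (him : i ≤ m) (hm : m ≤ n)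
    (h : ∀ j, i < j → j ≤ m → IsGreedyAt n k L j) : value n k L m ≤ value n k L i := by
  induction m, him using Nat.le_induction with
  | base => exact le_rfl
  | succ m him ih =>
    exact ((h (m + 1) (by omega) le_rfl).value_succ_le (by omega)).trans
      (ih (by omega) fun j h1 h2 => h j h1 (by omega))

/-- A policy that is greedy at all times is at least as good as every other one. -/
lemma value_le_value_of_isGreedyAt {n k : ℕ} {L : ℕ → ℕ}
    (h : ∀ i, 1 ≤ i → i ≤ n → IsGreedyAt n k L i) (L' : ℕ → ℕ) {m : ℕ} (hm : m ≤ n) :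
    value n k L' m ≤ value n k L m := by
  induction hm using Nat.decreasingInduction with
  | self => rw [value_end, value_end]
  | of_succ m hm ih =>
    have hm' : m < n := hm
    have h1 : ((m : ℝ) + 1) * value n k L' m ≤ ((m : ℝ) + 1) * value n k L m := by
      rw [mul_value L hm', mul_value L' hm']
      refine Finset.sum_le_sum fun y hy => ?_
      have hg := h (m + 1) (by omega) hm y (Finset.mem_Icc.1 hy).1
      split_ifs with h1 h2 h2
      · exact le_rfl
      · exact hg.2 (not_le.1 h2)
      · exact ih.trans (hg.1 h2)
      · exact ih
    exact le_of_mul_le_mul_left h1 (by positivity)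

namespace IsThresholdSystem

variable {n k : ℕ} {t : ℕ → ℕ}

/-- In the period `s l ≤ x + l ≤ s (l + 1)`, the gain of stopping over continuing with relative rank
`l` has the sign of `rhs l - d l x`. For `l = k` the period extends to time `n`. -/
lemma tail_sub_value (ht : IsThresholdSystem n k t) (hkn : k < n) {l x : ℕ} (hl : 1 ≤ l)
    (hlk : l ≤ k) (hx : t l ≤ x + 1) (hxn : x + l ≤ n) (hxt : l < k → x ≤ t (l + 1)) :
    tail n k (x + l) l - value n k (level k fun l => t l + l - 1) (x + l) =
      (x + l).descFactorial l * (l * (rhs n k t l - d n k l x)) := by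
  have hs := ht.isAdmissible hkn
  have hk : 1 ≤ k := hl.trans hlk
  -- The value at the right end of a period propagates to the whole period.
  have inner : ∀ l X, 1 ≤ l → l ≤ k → X + l ≤ n → (l < k → X ≤ t (l + 1)) →
      tail n k (X + l) l - value n k (level k fun l => t l + l - 1) (X + l) =
        (X + l).descFactorial l * (l * (rhs n k t l - d n k l X)) →
      ∀ x, x ≤ X → t l ≤ x + 1 →
      tail n k (x + l) l - value n k (level k fun l => t l + l - 1) (x + l) =
        (x + l).descFactorial l * (l * (rhs n k t l - d n k l x)) := by
    intro l X hl hlk hXn hXt hX x hxX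
    induction hxX using Nat.decreasingInduction with
    | self => exact fun _ => hX
    | of_succ x hxX ih =>
      intro htx
      have hxX' : x < X := hxX
      refine tail_sub_value_step hk hkn.le hl (by omega) ?_ (ih (by omega))
      refine le_antisymm ?_ ((lt_iff_le_level hs hl hlk).1 ?_)
      · by_contra hc
        have hc' := not_le.1 hc
        have h1 := level_le k (fun l => t l + l - 1) (x + 1 + l)
        have h2 := (lt_iff_le_level hs (show 1 ≤ l + 1 by omega) (by omega)).2 hc'
        have h3 := hXt (by omega)
        omega
      · omega
  induction hlk using Nat.decreasingInduction generalizing x with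
  | self =>
    refine inner k (n - k) hl le_rfl (by omega) (fun h => absurd h (lt_irrefl k)) ?_ x (by omega) hx
    rw [Nat.sub_add_cancel hkn.le, value_end, top_rhs hl hkn, tail_end hkn.le, if_pos le_rfl,
      sub_zero]
  | of_succ l hlk ih =>
    have hlk' : l < k := hlk
    obtain ⟨h1, h2, -⟩ := (ht (l + 1) (by omega) hlk).1
    refine inner l (t (l + 1)) hl hlk'.le (by omega) (fun _ => le_rfl) ?_ x (hxt hlk') hx
    obtain ⟨y, hy⟩ : ∃ y, t (l + 1) = y + 1 := ⟨t (l + 1) - 1, by omega⟩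
    have hE := ih (x := y) (by omega) (by omega) (by omega) fun h => by
      have := ht.le_succ hkn (show 1 ≤ l + 1 by omega) h
      omega
    have hR := mul_rhs (n := n) t hl hlk'
    have hD := d_succ_level (n := n) (k := k) (x := y) hk hl (by omega)
    have hT := tail_eq_add n k (y + 1 + l) l
    have e1 := cast_descFactorial_succ (x := y + 1) (l := l)
    rw [show y + (l + 1) = y + 1 + l by omega, e1] at hE
    rw [hy] at hR ⊢
    push_cast at *
    linear_combination hE + hT - hD - ((y + 1 + l).descFactorial l : ℝ) * hR

lemma isGreedyAt (ht : IsThresholdSystem n k t) (hkn : k < n) {i : ℕ} (hi : 1 ≤ i) (hin : i ≤ n) :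
    IsGreedyAt n k (level k fun l => t l + l - 1) i := by
  have hs := ht.isAdmissible hkn
  induction hj : n - i using Nat.strong_induction_on generalizing i with
  | _ j ih =>
  subst hj
  have later : ∀ j, i < j → j ≤ n → IsGreedyAt n k (level k fun l => t l + l - 1) j :=
    fun j h1 h2 => ih (n - j) (by omega) (by omega) h2 rfl
  have hLk := level_le k (fun l => t l + l - 1) i
  have hlt : ∀ l, 1 ≤ l → l ≤ k → (t l + l - 1 < i ↔ l ≤ level k (fun l => t l + l - 1) i) :=
    fun l h1 h2 => lt_iff_le_level hs h1 h2
  set L := level k (fun l => t l + l - 1) with hL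
  intro y hy1
  constructor
  -- The gain has the right sign after the threshold, because `d (L i)` is non-increasing.
  · intro hy
    have h0 : 1 ≤ L i := hy1.trans hy
    obtain ⟨h1, h2, h3⟩ := (ht (L i) h0 hLk).1
    have h4 := (hlt (L i) h0 hLk).2 le_rfl
    obtain ⟨x, hx⟩ : ∃ x, i = x + L i := ⟨i - L i, by omega⟩
    have hE := ht.tail_sub_value hkn h0 hLk (x := x) (by omega) (by omega) fun h => by
      by_contra hc
      have := (hlt (L i + 1) (by omega) h).1 (by omega)
      omega
    have hd := d_anti (n := n) (k := k) (h0.trans hLk) hkn.le h0 (show t (L i) ≤ x by omega)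
      (by omega)
    rw [← hx, ← hL] at hE
    have : 0 ≤ (i.descFactorial (L i) : ℝ) * ((L i : ℕ) * (rhs n k t (L i) - d n k (L i) x)) :=
      mul_nonneg (by positivity) (mul_nonneg (by positivity) (by linarith))
    exact (by linarith : value n k L i ≤ tail n k i (L i)).trans (tail_antitone n k i hy)
  · intro hy
    refine (tail_antitone n k i (show L i + 1 ≤ y from hy)).trans ?_
    rcases hLk.eq_or_lt with h | h
    · rw [tail_eq_zero_of_lt (by omega)]
      exact value_nonneg _ _ _ _
    obtain ⟨l, hl⟩ : ∃ l, l = L i + 1 := ⟨_, rfl⟩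
    rw [← hl]
    have hl1 : 1 ≤ l := by omega
    have hlk : l ≤ k := by omega
    obtain ⟨h1, h2, -⟩ := (ht l hl1 hlk).1
    have hil : ¬ t l + l - 1 < i := fun hc => by
      have := (hlt l hl1 hlk).1 hc
      omega
    obtain ⟨x, hx⟩ : ∃ x, t l = x + 1 := ⟨t l - 1, by omega⟩
    refine (tail_mono_time hkn.le (show i ≤ x + l by omega) (by omega) l).trans ?_
    refine le_trans ?_ (value_le_of_isGreedyAt (show i ≤ x + l by omega) (by omega)
      fun j h3 h4 => later j h3 (by omega))
    rcases Nat.eq_zero_or_pos x with rfl | hx0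
    -- Here `t l = 1`, and minimality says nothing about time `l`; but stopping there with the worst
    -- of the first `l` candidates is no better than waiting for the last candidate.
    · rw [Nat.zero_add] at *
      refine (tail_self_le hkn.le hl1 (by omega)).trans ?_
      rw [← value_pred hkn (level_end hs)]
      exact value_le_of_isGreedyAt (by omega) (by omega) fun j h3 h4 => later j (by omega) (by omega)
    · have hE := ht.tail_sub_value hkn hl1 hlk (x := x) (by omega) (by omega) fun h => by
        have := ht.le_succ hkn hl1 h
        omega
      have hd : rhs n k t l < d n k l x := by
        by_contra! hc
        have := (ht l hl1 hlk).2 ⟨hx0, by omega, hc⟩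
        omega
      rw [← hL] at hE
      have : (x + l).descFactorial l * ((l : ℝ) * (rhs n k t l - d n k l x)) ≤ 0 :=
        mul_nonpos_of_nonneg_of_nonpos (by positivity)
          (mul_nonpos_of_nonneg_of_nonpos (by positivity) (by linarith))
      linarith

lemma isOptimal (ht : IsThresholdSystem n k t) (hkn : k < n) :
    IsOptimal n k (fun l => t l + l - 1) := by
  refine ⟨ht.isAdmissible hkn, fun s' hs' => ?_⟩
  rw [successProb_eq_value hkn.le hs', successProb_eq_value hkn.le (ht.isAdmissible hkn)]
  exact value_le_value_of_isGreedyAt (fun i h1 h2 => ht.isGreedyAt hkn h1 h2) _ (Nat.zero_le n)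

end IsThresholdSystem

end Secretary

/-- The recursion from `l = k` down to `l = 1` is solvable (each minimum exists), and the resulting
sequence `s l = t l + l - 1` is optimal. -/
theorem theorem1 (n k : ℕ) (hk : 1 ≤ k) (hkn : k < n) :
    (∃ t : ℕ → ℕ, Secretary.IsThresholdSystem n k t) ∧
      ∀ t : ℕ → ℕ, Secretary.IsThresholdSystem n k t →
        Secretary.IsOptimal n k (fun l => t l + l - 1) :=
  ⟨Secretary.exists_isThresholdSystem hk hkn, fun _ ht => ht.isOptimal hkn⟩
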